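/- Let $\Omega=(-1,1)$, let $H^k(\Omega)$ be the usual Sobolev space of functions whose generalized derivatives of orders $0,\dots,k$ lie in $L^2(\Omega)$, and put $|w|_j=\|w^{(j)}\|_{L^2(\Omega)}$. For $w\in L^2(\Omega)$ let $\pi_p w$ denote the $L^2(\Omega)$-orthogonal projection of $w$ onto the polynomials of degree at most $p$. There is a constant $C>0$ such that for all integers $\nu\ge 0$, $p>\nu$, $k\ge\nu+1$, all integers $s$ with $0\le s\le\min\{p-\nu,\,k-\nu-1\}$, and all $w\in H^k(\Omega)$, the derivative $(w-\pi_p w)^{(\nu)}$ has a representative that is continuous on $[-1,1]$, and the values of this representative at $1$ and at $-1$ satisfy $$\left|(w-\pi_p w)^{(\nu)}(\pm1)\right|^2\le C\,p^{2\nu-1}\,\frac{(p-\nu-s)!}{(p-\nu+s)!}\,|w|_{s+\nu+1}^2 .$$ In particular $C$ does not depend on $p$, $\nu$, $s$, $k$ or $w$. -/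

import Mathlib

open MeasureTheory Set Polynomial
open scoped ContDiff

noncomputable section

namespace LegendreTrace

/-- The interval `Ω = (-1, 1)`. -/
def Ω : Set ℝ := Ioo (-1) 1

/-- Lebesgue measure on `Ω`. -/
def μΩ : Measure ℝ := volume.restrict Ω

/-- A test function: smooth, with compact support contained in `Ω`. -/
def IsTest (φ : ℝ → ℝ) : Prop :=
  ContDiff ℝ ∞ φ ∧ HasCompactSupport φ ∧ tsupport φ ⊆ Ω

/-- `g` is a weak (generalized) derivative of order `j` of `w` on `Ω`. -/
def IsWeakDeriv (j : ℕ) (w g : ℝ → ℝ) : Prop :=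
  LocallyIntegrableOn w Ω ∧ LocallyIntegrableOn g Ω ∧
    ∀ φ : ℝ → ℝ, IsTest φ →
      ∫ x in Ω, w x * iteratedDeriv j φ x = (-1) ^ j * ∫ x in Ω, g x * φ x

/-- The Sobolev space `H^k(Ω)`: square integrable functions whose generalized derivatives of
orders `0, …, k` exist and are square integrable on `Ω`. -/
def MemH (k : ℕ) (w : ℝ → ℝ) : Prop :=
  MemLp w 2 μΩ ∧ ∀ j ≤ k, ∃ g : ℝ → ℝ, MemLp g 2 μΩ ∧ IsWeakDeriv j w g

open Classical in
/-- A square integrable generalized derivative of order `j` of `w` on `Ω` (unique almost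
everywhere when it exists; `0` when there is none). -/
def weakDeriv (j : ℕ) (w : ℝ → ℝ) : ℝ → ℝ :=
  if h : ∃ g : ℝ → ℝ, MemLp g 2 μΩ ∧ IsWeakDeriv j w g then h.choose else 0

/-- The seminorm `|w|_j = ‖w^{(j)}‖_{L²(Ω)}`. -/
def seminormH (j : ℕ) (w : ℝ → ℝ) : ℝ :=
  Real.sqrt (∫ x in Ω, (weakDeriv j w x) ^ 2)

/-- `P` is the `L²(Ω)` projection of `w` onto the polynomials of degree at most `p`. -/
def IsL2Proj (p : ℕ) (w : ℝ → ℝ) (P : ℝ[X]) : Prop :=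
  P ∈ degreeLE ℝ p ∧
    ∀ v ∈ degreeLE ℝ p, ∫ x in Ω, (P.eval x - w x) * v.eval x = 0

theorem integrable_eval (P : ℝ[X]) : Integrable (fun x => P.eval x) μΩ :=
  (P.continuous.integrableOn_Icc (a := -1) (b := 1)).mono_set Ioo_subset_Icc_self

theorem integrable_mul_eval {w : ℝ → ℝ} (hw : MemLp w 2 μΩ) (P : ℝ[X]) :
    Integrable (fun x => w x * P.eval x) μΩ := by
  have hP : MemLp (fun x => P.eval x) 2 μΩ := by
    rw [memLp_two_iff_integrable_sq P.continuous.aestronglyMeasurable]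
    have h := integrable_eval (P * P)
    simpa only [eval_mul, sq] using h
  exact hw.integrable_mul hP

theorem eq_zero_of_integral_sq {P : ℝ[X]} (h : ∫ x in Ω, P.eval x * P.eval x = 0) : P = 0 := by
  have hi : Integrable (fun x => P.eval x * P.eval x) μΩ := by
    simpa using integrable_eval (P * P)
  have h0 := (integral_eq_zero_iff_of_nonneg (fun x => mul_self_nonneg (P.eval x)) hi).1 h
  have h1 : (fun x => P.eval x * P.eval x) =ᵐ[volume.restrict Ω] fun _ => (0 : ℝ) := h0
  have h2 : EqOn (fun x => P.eval x * P.eval x) (fun _ => (0 : ℝ)) Ω :=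
    Measure.eqOn_open_of_ae_eq h1 isOpen_Ioo
      (P.continuous.mul P.continuous).continuousOn continuousOn_const
  refine Polynomial.eq_zero_of_infinite_isRoot P ?_
  refine (Ioo_infinite (show (-1 : ℝ) < 1 by norm_num)).mono fun x hx => ?_
  exact mul_self_eq_zero.1 (h2 hx)

/-- Every function in `L²(Ω)` has an `L²` projection onto the polynomials of degree `≤ p`. -/
theorem exists_isL2Proj (p : ℕ) {w : ℝ → ℝ} (hw : MemLp w 2 μΩ) :
    ∃ P : ℝ[X], IsL2Proj p w P := by
  have key : ∀ P v : ℝ[X], Integrable (fun x => P.eval x * v.eval x) μΩ := fun P v => by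
    simpa using integrable_eval (P * v)
  let V := degreeLE ℝ (p : WithBot ℕ)
  have : FiniteDimensional ℝ V := by
    have : V = degreeLT ℝ (p + 1) := by
      ext q
      rw [mem_degreeLE, mem_degreeLT, ← natDegree_le_iff_degree_le, ← Nat.lt_succ_iff]
      by_cases hq : q = 0
      · simp [hq]
      · rw [natDegree_lt_iff_degree_lt hq]
    rw [this]
    exact (degreeLTEquiv ℝ (p + 1)).symm.finiteDimensional
  let B : V →ₗ[ℝ] Module.Dual ℝ V := LinearMap.mk₂ ℝ
    (fun P v => ∫ x, (P : ℝ[X]).eval x * (v : ℝ[X]).eval x ∂μΩ)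
    (fun a b v => by simp [add_mul, integral_add (key _ _) (key _ _)])
    (fun c a v => by simp [mul_assoc, integral_const_mul])
    (fun a b v => by simp [mul_add, integral_add (key _ _) (key _ _)])
    (fun c a v => by simp [mul_left_comm, integral_const_mul])
  let f : Module.Dual ℝ V :=
    { toFun := fun v => ∫ x, w x * (v : ℝ[X]).eval x ∂μΩ
      map_add' := fun a b => by
        simp [mul_add, integral_add (integrable_mul_eval hw _) (integrable_mul_eval hw _)]
      map_smul' := fun c a => by simp [mul_left_comm, integral_const_mul] }
  have hinj : Function.Injective B := by
    rw [injective_iff_map_eq_zero]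
    intro P hP
    exact Subtype.ext (eq_zero_of_integral_sq (LinearMap.congr_fun hP P))
  obtain ⟨P, hP⟩ := (LinearMap.injective_iff_surjective_of_finrank_eq_finrank
    (Subspace.dual_finrank_eq (K := ℝ) (V := V)).symm).1 hinj f
  refine ⟨P, P.2, fun v hv => ?_⟩
  have h := LinearMap.congr_fun hP ⟨v, hv⟩
  change ∫ x, (P : ℝ[X]).eval x * v.eval x ∂μΩ = ∫ x, w x * v.eval x ∂μΩ at h
  change ∫ x, ((P : ℝ[X]).eval x - w x) * v.eval x ∂μΩ = 0
  simp only [sub_mul]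
  rw [integral_sub (key _ _) (integrable_mul_eval hw _), h, sub_self]

open Classical in
/-- The `L²(Ω)` projection `π_p w` onto the polynomials of degree at most `p`
(junk value `0` when `w` is not square integrable on `Ω`). -/
def l2Proj (p : ℕ) (w : ℝ → ℝ) : ℝ[X] :=
  if h : MemLp w 2 μΩ then (exists_isL2Proj p h).choose else 0

theorem l2Proj_spec (p : ℕ) {w : ℝ → ℝ} (hw : MemLp w 2 μΩ) : IsL2Proj p w (l2Proj p w) := by
  rw [l2Proj, dif_pos hw]
  exact (exists_isL2Proj p hw).choose_spec

/-- The projection error `w - π_p w`. -/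
def projError (p : ℕ) (w : ℝ → ℝ) : ℝ → ℝ := fun x => w x - (l2Proj p w).eval x

/-- `u` is the representative of the generalized derivative `e^{(ν)}` that is continuous on the
closed interval `[-1, 1]`. Its values at `1` and `-1` are the traces `e^{(ν)}(1)`, `e^{(ν)}(-1)`. -/
def IsContDerivRep (ν : ℕ) (e u : ℝ → ℝ) : Prop :=
  ContinuousOn u (Icc (-1) 1) ∧ IsWeakDeriv ν e u

end LegendreTrace

end

/-!
Only the case of the endpoint `1` needs work: the reflection `x ↦ -x` gives `-1`, and it is enough
to treat a function `F 0` together with its absolutely continuous derivatives `F 1, …, F m`, the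
last of them square integrable (`IsSobolevChain`). By the du Bois-Reymond lemma every function of
`H^m(Ω)` has such a representative (`MemH.exists_isSobolevChain`), and continuous representatives
of a weak derivative are unique (`IsContDerivRep.eqOn`). Write `P` for the projection of `F 0` onto
polynomials of degree at most `p`, and `e = F 0 - P`. The proof is an induction on `ν` with the
constant `C = 144`.

*The value of the error itself.* Integrating by parts against Legendre polynomials gives
`2 e(1) = ∫ F 1 * (P_p + P_{p+1})` (`two_mul_error_eval_one`), so that no infinite expansion is
needed. The differentiated Legendre equation
`((1 - x²)^(t+1) P_n^(t+1))' = -(n - t)(n + t + 1) (1 - x²)^t P_n^(t)` turns `∫ F 1 * P_n` into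
`(n - t)! / (n + t)! * ∫ F (t+1) * (1 - x²)^t P_n^(t)`, and evaluates the weighted norm of
`P_n^(t)`. The Cauchy-Schwarz inequality then yields
`e(±1)² ≤ p⁻¹ (p - t)! / (p + t)! ‖F (t+1)‖²` for all `t ≤ p` (`sq_error_eval_one_le`).

*The induction step.* The projection of `F 1` onto polynomials of degree at most `p - 1` is
`P' + e(1) A - e(-1) B`, where `A` and `B` represent the evaluations at `1` and `-1` on these
polynomials (`IsProjDegreeLT.derivative`); explicitly `A = (P_p' + P_{p-1}') / 2` and
`B = ± (P_p' - P_{p-1}') / 2`. Hence `e^(ν)(1)` is the corresponding error for `F 1` with `p - 1`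
and `ν - 1` in place of `p` and `ν`, plus `e(1) A^(ν-1)(1) - e(-1) B^(ν-1)(1)`. Both kernels have
derivatives of size at most `P_p^(ν)(1) ≤ (p + ν)! / (p - ν)! ≤ 3 p^(2ν)` at `1`, and the endpoint
bound with `t = ν + s` controls the two extra terms
(`sq_error_iterate_derivative_eval_one_le`). Passing from `p - 1` to `p` at least doubles the weight
`p^(2ν-1)`, which absorbs the loss in `(a + b)² ≤ 4/3 a² + 4 b²` and keeps the constant independent
of `ν`.
-/

namespace LegendreTrace

/-! ### Integration by parts for primitives -/

/-- `f` is an absolutely continuous function on `[-1, 1]` whose derivative is the integrable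
function `g`, expressed by the fundamental theorem of calculus. -/
structure IsPrimitive (f g : ℝ → ℝ) : Prop where
  intervalIntegrable : IntervalIntegrable g volume (-1) 1
  eq_add_integral : ∀ x ∈ Icc (-1 : ℝ) 1, f x = f (-1) + ∫ t in (-1 : ℝ)..x, g t

theorem IsPrimitive.continuousOn {f g : ℝ → ℝ} (h : IsPrimitive f g) :
    ContinuousOn f (Icc (-1) 1) := by
  have h1 := (h.intervalIntegrable.absolutelyContinuousOnInterval_intervalIntegral
    (c := -1) (by simp)).continuousOn
  rw [uIcc_of_le (by norm_num)] at h1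
  exact (continuousOn_const.add h1).congr h.eq_add_integral

theorem IsPrimitive.intervalIntegrable_left {f g : ℝ → ℝ} (h : IsPrimitive f g) :
    IntervalIntegrable f volume (-1) 1 := by
  apply ContinuousOn.intervalIntegrable
  rw [uIcc_of_le (by norm_num)]
  exact h.continuousOn

/-- Integration by parts of an absolutely continuous function against a `C¹` function. -/
theorem IsPrimitive.integral_mul {f g q : ℝ → ℝ} (h : IsPrimitive f g) (hq : ContDiff ℝ 1 q) :
    ∫ x in (-1 : ℝ)..1, g x * q x =
      f 1 * q 1 - f (-1) * q (-1) - ∫ x in (-1 : ℝ)..1, f x * deriv q x := by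
  have hac : AbsolutelyContinuousOnInterval (fun x => f (-1) + ∫ t in (-1 : ℝ)..x, g t) (-1) 1 :=
    (contDiff_const.contDiffOn.absolutelyContinuousOnInterval).fun_add
      (h.intervalIntegrable.absolutelyContinuousOnInterval_intervalIntegral (by simp))
  have hqac : AbsolutelyContinuousOnInterval q (-1) 1 :=
    hq.contDiffOn.absolutelyContinuousOnInterval
  have key := hqac.integral_mul_deriv_eq_deriv_mul hac
  have h1 : ∫ x in (-1 : ℝ)..1, q x * deriv (fun x => f (-1) + ∫ t in (-1 : ℝ)..x, g t) x =
      ∫ x in (-1 : ℝ)..1, g x * q x := by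
    apply intervalIntegral.integral_congr_ae
    filter_upwards [h.intervalIntegrable.ae_hasDerivAt_integral] with x hx hx'
    have := (hx (uIoc_subset_uIcc hx') (-1) (by simp)).const_add (f (-1))
    rw [this.deriv, mul_comm]
  have h2 : ∫ x in (-1 : ℝ)..1, deriv q x * (f (-1) + ∫ t in (-1 : ℝ)..x, g t) =
      ∫ x in (-1 : ℝ)..1, f x * deriv q x := by
    apply intervalIntegral.integral_congr
    intro x hx
    rw [uIcc_of_le (by norm_num)] at hx
    simp only
    rw [← h.eq_add_integral x hx, mul_comm]
  rw [h1, h2, ← h.eq_add_integral 1 (by norm_num), ← h.eq_add_integral (-1) (by norm_num)] at key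
  rw [key]
  ring

theorem IsPrimitive.integral_mul_eval {f g : ℝ → ℝ} (h : IsPrimitive f g) (q : ℝ[X]) :
    ∫ x in (-1 : ℝ)..1, g x * q.eval x =
      f 1 * q.eval 1 - f (-1) * q.eval (-1) -
        ∫ x in (-1 : ℝ)..1, f x * (derivative q).eval x := by
  simpa only [Polynomial.deriv] using h.integral_mul (q := fun x => q.eval x) (by
    simpa only [Polynomial.coe_aeval_eq_eval] using q.contDiff_aeval (𝕜 := ℝ) 1)

/-- The reflection `x ↦ -x` maps primitives to primitives. -/
theorem IsPrimitive.reflect {f g : ℝ → ℝ} (h : IsPrimitive f g) (c : ℝ) :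
    IsPrimitive (fun x => c * f (-x)) (fun x => -c * g (-x)) := by
  have hg := h.intervalIntegrable
  have hg' : IntervalIntegrable (fun x => g (-x)) volume (-1) 1 := by
    simpa using ((IntervalIntegrable.iff_comp_neg (by simp)).1 hg).symm
  refine ⟨hg'.const_mul _, fun x hx => ?_⟩
  have hx' : -x ∈ Icc (-1 : ℝ) 1 := ⟨by linarith [hx.2], by linarith [hx.1]⟩
  have h1 := h.eq_add_integral (-x) hx'
  have h2 := h.eq_add_integral 1 (by norm_num)
  have h3 : (∫ t in (-1 : ℝ)..-x, g t) + ∫ t in -x..1, g t = ∫ t in (-1 : ℝ)..1, g t :=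
    intervalIntegral.integral_add_adjacent_intervals
      (hg.mono_set (by
        rw [uIcc_of_le hx'.1, uIcc_of_le (by norm_num)]; exact Icc_subset_Icc_right hx'.2))
      (hg.mono_set (by
        rw [uIcc_of_le hx'.2, uIcc_of_le (by norm_num)]; exact Icc_subset_Icc_left hx'.1))
  rw [intervalIntegral.integral_const_mul, intervalIntegral.integral_comp_neg, neg_neg, neg_mul,
    h1, h2, ← h3]
  ring

theorem isPrimitive_eval (q : ℝ[X]) :
    IsPrimitive (fun x => q.eval x) (fun x => (derivative q).eval x) := by
  have hi : ∀ a b, IntervalIntegrable (fun x => (derivative q).eval x) volume a b :=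
    fun a b => (derivative q).continuous.intervalIntegrable a b
  refine ⟨hi _ _, fun x _ => ?_⟩
  rw [intervalIntegral.integral_eq_sub_of_hasDerivAt (fun y _ => q.hasDerivAt y) (hi _ _)]
  ring

/-- The Cauchy-Schwarz inequality for a square integrable function and a polynomial. -/
theorem sq_integral_mul_eval_le {f : ℝ → ℝ} (hf : IntervalIntegrable f volume (-1) 1)
    (hf2 : IntervalIntegrable (fun x => f x ^ 2) volume (-1) 1) (q : ℝ[X]) :
    (∫ x in (-1 : ℝ)..1, f x * q.eval x) ^ 2 ≤
      (∫ x in (-1 : ℝ)..1, f x ^ 2) * ∫ x in (-1 : ℝ)..1, q.eval x ^ 2 := by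
  have h1 : IntervalIntegrable (fun x => f x * q.eval x) volume (-1) 1 :=
    hf.mul_continuousOn q.continuous.continuousOn
  have h2 : IntervalIntegrable (fun x => q.eval x ^ 2) volume (-1) 1 :=
    (q.continuous.pow 2).intervalIntegrable _ _
  have key : ∀ t : ℝ, 0 ≤ (∫ x in (-1 : ℝ)..1, q.eval x ^ 2) * (t * t) +
      (2 * ∫ x in (-1 : ℝ)..1, f x * q.eval x) * t + ∫ x in (-1 : ℝ)..1, f x ^ 2 := by
    intro t
    have h0 : 0 ≤ ∫ x in (-1 : ℝ)..1, (q.eval x ^ 2 * (t * t) + (f x * q.eval x) * (2 * t)) +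
        f x ^ 2 :=
      intervalIntegral.integral_nonneg (by norm_num) fun x _ => by
        nlinarith [sq_nonneg (t * q.eval x + f x)]
    rw [intervalIntegral.integral_add ((h2.mul_const _).add (h1.mul_const _)) hf2,
      intervalIntegral.integral_add (h2.mul_const _) (h1.mul_const _),
      intervalIntegral.integral_mul_const, intervalIntegral.integral_mul_const] at h0
    linarith
  have := discrim_le_zero key
  rw [discrim] at this
  nlinarith

/-! ### Legendre polynomials -/

/-- The Legendre polynomial of degree `n`, normalised to have the value `1` at `1`, given by the
formula of Rodrigues. -/
noncomputable def legendre (n : ℕ) : ℝ[X] :=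
  C ((2 ^ n * n.factorial : ℝ)⁻¹) * derivative^[n] ((X ^ 2 - 1) ^ n)

/-- The differential equation of `(X ^ 2 - 1) ^ n`, differentiated `k + 1` times. -/
theorem iterate_derivative_X_sq_sub_one_pow (n k : ℕ) :
    (X ^ 2 - 1) * derivative^[k + 2] ((X ^ 2 - 1 : ℝ[X]) ^ n) =
      C (2 * n - 2 * (k + 1) : ℝ) * X * derivative^[k + 1] ((X ^ 2 - 1) ^ n) +
        C ((k + 1) * (2 * n - k) : ℝ) * derivative^[k] ((X ^ 2 - 1) ^ n) := by
  induction k with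
  | zero =>
    have h : (X ^ 2 - 1) * derivative ((X ^ 2 - 1 : ℝ[X]) ^ n) =
        C (2 * n : ℝ) * X * (X ^ 2 - 1) ^ n := by
      rcases n with _ | n
      · simp
      · simp [derivative_pow]
        ring
    have h' := congrArg derivative h
    simp only [derivative_mul, derivative_sub, derivative_X_pow, derivative_one, derivative_X,
      derivative_C] at h'
    simp only [Function.iterate_succ_apply', Function.iterate_zero, id]
    simp only [map_sub, map_mul, map_add, map_natCast, map_ofNat, map_one, map_zero,
      Nat.cast_zero, Nat.cast_ofNat] at h' ⊢
    linear_combination h'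
  | succ k ih =>
    have h' := congrArg derivative ih
    simp only [derivative_mul, derivative_sub, derivative_add, derivative_X_pow, derivative_one,
      derivative_X, derivative_C, ← Function.iterate_succ_apply' derivative] at h'
    simp only [Nat.succ_eq_add_one, map_sub, map_mul, map_add, map_natCast, map_ofNat, map_one,
      Nat.cast_add, Nat.cast_one, Nat.cast_ofNat] at h' ⊢
    linear_combination h'

/-- The Legendre differential equation, differentiated `t` times. -/
theorem legendre_ode (n t : ℕ) :
    (1 - X ^ 2) * derivative^[t + 2] (legendre n) =
      C (2 * (t + 1) : ℝ) * X * derivative^[t + 1] (legendre n) -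
        C ((n - t) * (n + t + 1) : ℝ) * derivative^[t] (legendre n) := by
  have h := iterate_derivative_X_sq_sub_one_pow n (t + n)
  simp only [legendre, iterate_derivative_C_mul, ← Function.iterate_add_apply]
  rw [show t + 2 + n = t + n + 2 by ring, show t + 1 + n = t + n + 1 by ring]
  generalize C ((2 ^ n * n.factorial : ℝ)⁻¹) = c
  simp only [map_sub, map_mul, map_add, map_natCast, map_ofNat, map_one,
      Nat.cast_add] at h ⊢
  linear_combination (-c) * h

theorem X_sq_sub_one_pow_eq (n : ℕ) (r : ℝ) (hr : r ^ 2 = 1) :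
    ((X ^ 2 - 1 : ℝ[X]) ^ n).map (algebraMap ℝ ℝ) = (X - C r) ^ n * (X + C r) ^ n := by
  have h : (C r : ℝ[X]) ^ 2 = 1 := by rw [← map_pow, hr, map_one]
  rw [Algebra.algebraMap_self, Polynomial.map_id, ← mul_pow]
  congr 1
  linear_combination h

theorem eval_iterate_derivative_X_sq_sub_one_pow {n k : ℕ} (hk : k < n) {r : ℝ}
    (hr : r ^ 2 = 1) : (derivative^[k] ((X ^ 2 - 1 : ℝ[X]) ^ n)).eval r = 0 := by
  simpa only [Polynomial.coe_aeval_eq_eval] using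
    aeval_iterate_derivative_of_lt _ n r (X_sq_sub_one_pow_eq n r hr) hk

theorem eval_legendre (n : ℕ) {r : ℝ} (hr : r ^ 2 = 1) : (legendre n).eval r = r ^ n := by
  have h := aeval_iterate_derivative_self _ n r (X_sq_sub_one_pow_eq n r hr)
  rw [Polynomial.coe_aeval_eq_eval] at h
  rw [legendre, eval_mul, eval_C, h]
  simp only [eval_pow, eval_add, eval_X, eval_C, nsmul_eq_mul, ← two_mul, mul_pow]
  have : (n.factorial : ℝ) ≠ 0 := by positivity
  field_simp

theorem eval_one_legendre (n : ℕ) : (legendre n).eval 1 = 1 := by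
  simpa using eval_legendre n (one_pow 2)

theorem eval_neg_one_legendre (n : ℕ) : (legendre n).eval (-1) = (-1) ^ n :=
  eval_legendre n (by norm_num)

theorem natDegree_legendre_le (n : ℕ) : (legendre n).natDegree ≤ n := by
  refine (natDegree_C_mul_le _ _).trans ((natDegree_iterate_derivative _ _).trans ?_)
  have h : ((X ^ 2 - 1 : ℝ[X]) ^ n).natDegree ≤ n * 2 :=
    natDegree_pow_le_of_le n (by compute_degree)
  omega

theorem degree_derivative_lt_of_degree_lt_succ {q : ℝ[X]} {n : ℕ}
    (hq : q.degree < ((n + 1 : ℕ) : WithBot ℕ)) : (derivative q).degree < (n : WithBot ℕ) := by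
  rw [degree_lt_iff_coeff_zero] at hq ⊢
  intro m hm
  rw [coeff_derivative, hq (m + 1) (by omega), zero_mul]

/-- Legendre polynomials are orthogonal to all polynomials of lower degree. -/
theorem integral_mul_legendre_eq_zero {n : ℕ} {q : ℝ[X]} (hq : q.degree < (n : WithBot ℕ)) :
    ∫ x in (-1 : ℝ)..1, q.eval x * (legendre n).eval x = 0 := by
  have key : ∀ k ≤ n, ∀ q : ℝ[X], q.degree < (k : WithBot ℕ) →
      ∫ x in (-1 : ℝ)..1, (derivative^[k] ((X ^ 2 - 1 : ℝ[X]) ^ n)).eval x * q.eval x = 0 := by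
    intro k
    induction k with
    | zero =>
      intro _ q hq
      have : q = 0 := by
        by_contra h0
        exact absurd (zero_le_degree_iff.2 h0) (not_le.2 (by simpa using hq))
      simp [this]
    | succ k ih =>
      intro hk q hq
      rw [Function.iterate_succ_apply', (isPrimitive_eval _).integral_mul_eval,
        eval_iterate_derivative_X_sq_sub_one_pow hk (by norm_num),
        eval_iterate_derivative_X_sq_sub_one_pow hk (by norm_num),
        ih (by omega) _ (degree_derivative_lt_of_degree_lt_succ hq)]
      ring
  simp only [legendre, eval_mul, eval_C]
  rw [← mul_zero (2 ^ n * n.factorial : ℝ)⁻¹, ← key n le_rfl q hq,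
    ← intervalIntegral.integral_const_mul]
  congr 1
  ext x
  ring

theorem integral_legendre_sq (n : ℕ) :
    ∫ x in (-1 : ℝ)..1, (legendre n).eval x ^ 2 = 2 / (2 * n + 1) := by
  set P := legendre n with hP
  -- `X * P' - n * P` has degree less than `n`, since the leading terms cancel.
  have hdeg : (X * derivative P - C (n : ℝ) * P).degree < (n : WithBot ℕ) := by
    rw [degree_lt_iff_coeff_zero]
    intro m hm
    have h0 : ∀ m, n < m → P.coeff m = 0 := fun m hm =>
      coeff_eq_zero_of_natDegree_lt ((natDegree_legendre_le n).trans_lt hm)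
    rcases m with _ | m
    · obtain rfl : n = 0 := by omega
      simp
    · rw [coeff_sub, coeff_X_mul, coeff_derivative, coeff_C_mul]
      rcases hm.eq_or_lt with h | h
      · rw [h]; push_cast; ring
      · rw [h0 _ h]; ring
  have h1 := integral_mul_legendre_eq_zero hdeg
  have h2 := (isPrimitive_eval P).integral_mul_eval (X * P)
  have e1 : ∫ x in (-1 : ℝ)..1, (X * derivative P - C (n : ℝ) * P).eval x * P.eval x =
      (∫ x in (-1 : ℝ)..1, (derivative P).eval x * (X * P).eval x) -
        n * ∫ x in (-1 : ℝ)..1, P.eval x ^ 2 := by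
    rw [← intervalIntegral.integral_const_mul, ← intervalIntegral.integral_sub]
    · congr 1; ext x; simp; ring
    · exact Continuous.intervalIntegrable (by fun_prop) _ _
    · exact Continuous.intervalIntegrable (by fun_prop) _ _
  have e2 : ∫ x in (-1 : ℝ)..1, P.eval x * (derivative (X * P)).eval x =
      (∫ x in (-1 : ℝ)..1, (derivative P).eval x * (X * P).eval x) +
        ∫ x in (-1 : ℝ)..1, P.eval x ^ 2 := by
    rw [← intervalIntegral.integral_add]
    · congr 1; ext x; simp; ring
    · exact Continuous.intervalIntegrable (by fun_prop) _ _
    · exact Continuous.intervalIntegrable (by fun_prop) _ _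
  rw [← hP, e1] at h1
  have e3 : ((-1 : ℝ) ^ n) * (-1) ^ n = 1 := by rw [← mul_pow]; norm_num
  rw [e2] at h2
  simp only [eval_mul, eval_X, hP, eval_one_legendre, eval_neg_one_legendre] at h1 h2
  rw [eq_div_iff (by positivity)]
  linear_combination (-2) * h1 + h2 + e3

/-! ### Factorial ratios -/

/-- `(n + t)! / (n - t)!`, the product of the eigenvalues `(n - j) * (n + j + 1)`, `j < t`, of the
differentiated Legendre equations; it is meant for `t ≤ n` only. -/
noncomputable def factRatio (n t : ℕ) : ℝ := ((n + t).factorial : ℝ) / ((n - t).factorial : ℝ)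

theorem factRatio_pos (n t : ℕ) : 0 < factRatio n t := by unfold factRatio; positivity

theorem factRatio_zero (n : ℕ) : factRatio n 0 = 1 := by
  simp [factRatio, div_self (show (n.factorial : ℝ) ≠ 0 by positivity)]

theorem factRatio_succ {n t : ℕ} (h : t < n) :
    factRatio n (t + 1) = (n - t) * (n + t + 1) * factRatio n t := by
  obtain ⟨d, rfl⟩ : ∃ d, n = t + 1 + d := ⟨n - (t + 1), by omega⟩
  have h1 : t + 1 + d - (t + 1) = d := by omega
  have h2 : t + 1 + d - t = d + 1 := by omega
  have h3 : t + 1 + d + (t + 1) = (t + 1 + d + t) + 1 := by ring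
  rw [factRatio, factRatio, h1, h2, h3, Nat.factorial_succ, Nat.factorial_succ]
  push_cast
  have : (d.factorial : ℝ) ≠ 0 := by positivity
  field_simp
  ring

theorem factRatio_mono_left {n t : ℕ} (h : t ≤ n) : factRatio n t ≤ factRatio (n + 1) t := by
  induction t with
  | zero => simp [factRatio_zero]
  | succ t ih =>
    rw [factRatio_succ h, factRatio_succ (by omega)]
    have h1 : (t : ℝ) + 1 ≤ n := by exact_mod_cast h
    have := ih (by omega)
    have := (factRatio_pos n t).le
    gcongr <;> push_cast <;> nlinarith

theorem factRatio_mul_le {p ν s : ℕ} (hν : ν ≤ p) (h : s ≤ p - ν) :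
    factRatio p ν * factRatio (p - ν) s ≤ factRatio p (ν + s) := by
  induction s with
  | zero => simp [factRatio_zero]
  | succ s ih =>
    rw [factRatio_succ (by omega), ← add_assoc, factRatio_succ (by omega)]
    have := ih (by omega)
    have h1 := (factRatio_pos p ν).le
    have h2 := (factRatio_pos (p - ν) s).le
    have h3 : (ν : ℝ) + s + 1 ≤ p := by
      have : ν + s + 1 ≤ p := by omega
      exact_mod_cast this
    have h4 : (0 : ℝ) ≤ ν := by positivity
    have h5 : (0 : ℝ) ≤ s := by positivity
    rw [Nat.cast_sub hν]
    push_cast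
    calc factRatio p ν * (((p : ℝ) - ν - s) * (p - ν + s + 1) * factRatio (p - ν) s)
        = ((p : ℝ) - ν - s) * (p - ν + s + 1) * (factRatio p ν * factRatio (p - ν) s) := by ring
      _ ≤ ((p : ℝ) - (ν + s)) * (p + (ν + s) + 1) * factRatio p (ν + s) :=
        mul_le_mul (by nlinarith) this (by positivity) (mul_nonneg (by linarith) (by linarith))

/-- The bound `(p + ν)! / (p - ν)! ≤ (p (p + 1)) ^ ν ≤ e p ^ (2 ν)`. -/
theorem factRatio_le {p ν : ℕ} (h : ν ≤ p) : factRatio p ν ≤ 3 * (p : ℝ) ^ (2 * ν) := by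
  rcases Nat.eq_zero_or_pos p with rfl | hp
  · obtain rfl : ν = 0 := by omega
    norm_num [factRatio_zero]
  have hp' : (0 : ℝ) < p := by exact_mod_cast hp
  have h1 : factRatio p ν ≤ (p * (p + 1) : ℝ) ^ ν := by
    induction ν with
    | zero => simp [factRatio_zero]
    | succ ν ih =>
      rw [factRatio_succ h, pow_succ']
      have h1 : (ν : ℝ) + 1 ≤ p := by exact_mod_cast h
      have h4 : (0 : ℝ) ≤ ν := by positivity
      have := ih (by omega)
      exact mul_le_mul (by nlinarith) this (factRatio_pos _ _).le (by positivity)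
  have h2 : (1 + 1 / p : ℝ) ^ ν ≤ 3 := by
    calc (1 + 1 / p : ℝ) ^ ν ≤ (Real.exp (1 / p)) ^ ν := by
          gcongr
          linarith [Real.add_one_le_exp (1 / p : ℝ)]
      _ = Real.exp (ν * (1 / p)) := by rw [← Real.exp_nat_mul]
      _ ≤ Real.exp 1 := by
          gcongr
          rw [mul_one_div, div_le_one hp']
          exact_mod_cast h
      _ ≤ 3 := by linarith [Real.exp_one_lt_d9]
  calc factRatio p ν ≤ (p * (p + 1) : ℝ) ^ ν := h1
    _ = (1 + 1 / p : ℝ) ^ ν * (p : ℝ) ^ (2 * ν) := by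
        rw [pow_mul, ← mul_pow]; congr 1; field_simp
    _ ≤ 3 * (p : ℝ) ^ (2 * ν) := by gcongr

/-! ### Derivatives of Legendre polynomials -/

theorem eval_one_iterate_derivative_legendre_succ (n t : ℕ) :
    2 * (t + 1) * (derivative^[t + 1] (legendre n)).eval 1 =
      (n - t) * (n + t + 1) * (derivative^[t] (legendre n)).eval 1 := by
  have h := congrArg (eval 1) (legendre_ode n t)
  simp only [eval_mul, eval_sub, eval_pow, eval_X, eval_one, eval_C] at h
  linarith

theorem eval_one_iterate_derivative_legendre_nonneg {n t : ℕ} (h : t ≤ n) :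
    0 ≤ (derivative^[t] (legendre n)).eval 1 := by
  induction t with
  | zero => simp [eval_one_legendre]
  | succ t ih =>
    have h1 := eval_one_iterate_derivative_legendre_succ n t
    have h2 : (t : ℝ) + 1 ≤ n := by exact_mod_cast h
    have h3 : 0 ≤ (n - t) * (n + t + 1) * (derivative^[t] (legendre n)).eval 1 :=
      mul_nonneg (mul_nonneg (by linarith) (by positivity)) (ih (by omega))
    rw [← h1] at h3
    exact nonneg_of_mul_nonneg_right h3 (by positivity)

theorem eval_one_iterate_derivative_legendre_mono {n t : ℕ} (h : t ≤ n) :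
    (derivative^[t] (legendre n)).eval 1 ≤ (derivative^[t] (legendre (n + 1))).eval 1 := by
  induction t with
  | zero => simp [eval_one_legendre]
  | succ t ih =>
    have h1 := eval_one_iterate_derivative_legendre_succ n t
    have h2 := eval_one_iterate_derivative_legendre_succ (n + 1) t
    have h3 : (t : ℝ) + 1 ≤ n := by exact_mod_cast h
    have h4 := eval_one_iterate_derivative_legendre_nonneg (n := n) (t := t) (by omega)
    have h5 := ih (by omega)
    refine le_of_mul_le_mul_left (a := (2 * (t + 1) : ℝ)) ?_ (by positivity)
    rw [h1, h2]
    have h6 : (0 : ℝ) ≤ t := by positivity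
    gcongr <;> push_cast <;> nlinarith

theorem eval_one_iterate_derivative_legendre_le {n t : ℕ} (h : t ≤ n) :
    (derivative^[t] (legendre n)).eval 1 ≤ factRatio n t := by
  induction t with
  | zero => simp [eval_one_legendre, factRatio_zero]
  | succ t ih =>
    have h1 := eval_one_iterate_derivative_legendre_succ n t
    have h2 := eval_one_iterate_derivative_legendre_nonneg h
    have h3 : (t : ℝ) + 1 ≤ n := by exact_mod_cast h
    have h6 : (0 : ℝ) ≤ t := by positivity
    rw [factRatio_succ h]
    calc _ ≤ 2 * (t + 1) * (derivative^[t + 1] (legendre n)).eval 1 := by nlinarith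
      _ = _ := h1
      _ ≤ _ := by
        gcongr
        · exact mul_nonneg (by linarith) (by positivity)
        · exact ih (by omega)

/-- The weighted derivative `(1 - x²)ᵗ Pₙ⁽ᵗ⁾`. Up to the factor `± (n - t)! / (n + t)!` it is a
`t`-fold primitive of `Pₙ` all of whose boundary terms vanish. -/
noncomputable def weightedLegendre (n t : ℕ) : ℝ[X] :=
  (1 - X ^ 2) ^ t * derivative^[t] (legendre n)

theorem derivative_weightedLegendre_succ (n t : ℕ) :
    derivative (weightedLegendre n (t + 1)) =
      C (-((n - t) * (n + t + 1)) : ℝ) * weightedLegendre n t := by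
  have h := legendre_ode n t
  simp only [weightedLegendre, derivative_mul, derivative_pow, derivative_sub, derivative_one,
    derivative_X, ← Function.iterate_succ_apply' derivative, Nat.succ_eq_add_one,
    add_tsub_cancel_right]
  simp only [map_neg, map_sub, map_mul, map_add, map_natCast, map_ofNat, map_one,
      Nat.cast_add, Nat.cast_one, Nat.cast_ofNat] at h ⊢
  linear_combination (1 - X ^ 2) ^ t * h

theorem eval_weightedLegendre_succ (n t : ℕ) {r : ℝ} (hr : r ^ 2 = 1) :
    (weightedLegendre n (t + 1)).eval r = 0 := by
  simp [weightedLegendre, hr]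

theorem integral_weightedLegendre_mul {n t : ℕ} (h : t ≤ n) :
    ∫ x in (-1 : ℝ)..1, (derivative^[t] (legendre n)).eval x * (weightedLegendre n t).eval x =
      factRatio n t * (2 / (2 * n + 1)) := by
  induction t with
  | zero => simp [weightedLegendre, factRatio_zero, ← integral_legendre_sq, sq]
  | succ t ih =>
    rw [Function.iterate_succ_apply', (isPrimitive_eval _).integral_mul_eval,
      eval_weightedLegendre_succ _ _ (by norm_num), eval_weightedLegendre_succ _ _ (by norm_num),
      derivative_weightedLegendre_succ, factRatio_succ h, mul_assoc, ← ih (by omega),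
      mul_zero, mul_zero, sub_zero, zero_sub, ← intervalIntegral.integral_const_mul,
      ← intervalIntegral.integral_neg]
    congr 1
    ext x
    simp
    ring

theorem integral_weightedLegendre_sq_le {n t : ℕ} (h : t ≤ n) :
    ∫ x in (-1 : ℝ)..1, (weightedLegendre n t).eval x ^ 2 ≤
      factRatio n t * (2 / (2 * n + 1)) := by
  rw [← integral_weightedLegendre_mul h]
  refine intervalIntegral.integral_mono_on (by norm_num)
    (((weightedLegendre n t).continuous.pow 2).intervalIntegrable _ _)
    (((derivative^[t] (legendre n)).continuous.mul
      (weightedLegendre n t).continuous).intervalIntegrable _ _) fun x hx => ?_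
  simp only [weightedLegendre, eval_mul, eval_pow, eval_sub, eval_one, eval_X]
  have h0 : 0 ≤ (1 - x ^ 2) := by nlinarith [hx.1, hx.2]
  have h1 : (1 - x ^ 2) ^ t ≤ 1 := pow_le_one₀ h0 (by nlinarith)
  have h2 : 0 ≤ (1 - x ^ 2) ^ t := by positivity
  generalize (1 - x ^ 2) ^ t = a at h1 h2
  generalize eval x (derivative^[t] (legendre n)) = b
  nlinarith [mul_nonneg (mul_nonneg h2 (sub_nonneg.2 h1)) (sq_nonneg b)]

/-! ### Endpoint values of the projection error -/

/-- A function `F 0` with its successive derivatives `F 1, …, F m`: each is the derivative of the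
preceding one in the sense of absolutely continuous functions, and the last is square
integrable. -/
structure IsSobolevChain (m : ℕ) (F : ℕ → ℝ → ℝ) : Prop where
  isPrimitive : ∀ j < m, IsPrimitive (F j) (F (j + 1))
  integrable_sq : IntervalIntegrable (fun x => F m x ^ 2) volume (-1) 1

/-- `P` is the `L²` projection of `f` onto the polynomials of degree less than `n`. -/
structure IsProjDegreeLT (n : ℕ) (f : ℝ → ℝ) (P : ℝ[X]) : Prop where
  degree_lt : P.degree < (n : WithBot ℕ)
  integral_mul_eq : ∀ v : ℝ[X], v.degree < (n : WithBot ℕ) →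
    ∫ x in (-1 : ℝ)..1, f x * v.eval x = ∫ x in (-1 : ℝ)..1, P.eval x * v.eval x

theorem IsSobolevChain.reflect {m : ℕ} {F : ℕ → ℝ → ℝ} (h : IsSobolevChain m F) :
    IsSobolevChain m (fun j x => (-1) ^ j * F j (-x)) := by
  refine ⟨fun j hj => ?_, ?_⟩
  · simpa [pow_succ] using (h.isPrimitive j hj).reflect ((-1) ^ j)
  · have h1 := ((IntervalIntegrable.iff_comp_neg (by simp)).1 h.integrable_sq).symm
    simpa [mul_pow, ← pow_mul, mul_comm] using h1

theorem IsProjDegreeLT.reflect {n : ℕ} {f : ℝ → ℝ} {P : ℝ[X]} (h : IsProjDegreeLT n f P) :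
    IsProjDegreeLT n (fun x => f (-x)) (P.comp (-X)) := by
  have hdeg : ∀ q : ℝ[X], q.degree < (n : WithBot ℕ) → (q.comp (-X)).degree < (n : WithBot ℕ) := by
    intro q hq
    simpa using hq
  refine ⟨hdeg P h.degree_lt, fun v hv => ?_⟩
  have h1 := h.integral_mul_eq _ (hdeg v hv)
  have e1 := intervalIntegral.integral_comp_neg (a := -1) (b := 1)
    (fun x => f x * (v.comp (-X)).eval x)
  have e2 := intervalIntegral.integral_comp_neg (a := -1) (b := 1)
    (fun x => P.eval x * (v.comp (-X)).eval x)
  rw [neg_neg] at e1 e2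
  rw [← e1, ← e2] at h1
  simpa using h1

theorem iterate_derivative_comp_neg_X (P : ℝ[X]) (k : ℕ) :
    derivative^[k] (P.comp (-X)) = C ((-1) ^ k : ℝ) * (derivative^[k] P).comp (-X) := by
  induction k with
  | zero => simp
  | succ k ih =>
    rw [Function.iterate_succ_apply', ih, Function.iterate_succ_apply']
    simp [derivative_comp, pow_succ]

/-- Repeated integration by parts expresses the Legendre moments of the first derivative by weighted
moments of the derivative of order `t + 1`. -/
theorem integral_mul_legendre_eq {n t : ℕ} {F : ℕ → ℝ → ℝ}
    (hF : ∀ j < t + 1, IsPrimitive (F j) (F (j + 1))) (h : t ≤ n) :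
    ∫ x in (-1 : ℝ)..1, F 1 x * (legendre n).eval x =
      (factRatio n t)⁻¹ * ∫ x in (-1 : ℝ)..1, F (t + 1) x * (weightedLegendre n t).eval x := by
  induction t with
  | zero => simp [weightedLegendre, factRatio_zero]
  | succ t ih =>
    rw [ih (fun j hj => hF j (by omega)) (by omega),
      (hF (t + 1) (by omega)).integral_mul_eval, eval_weightedLegendre_succ _ _ (by norm_num),
      eval_weightedLegendre_succ _ _ (by norm_num), derivative_weightedLegendre_succ,
      factRatio_succ h]
    have h1 : (t : ℝ) + 1 ≤ n := by exact_mod_cast h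
    have h2 : (n : ℝ) - t ≠ 0 := by linarith
    have h3 : (n : ℝ) + t + 1 ≠ 0 := by positivity
    have h4 := (factRatio_pos n t).ne'
    have h5 : ∫ x in (-1 : ℝ)..1, F (t + 1) x *
        (C (-((n - t) * (n + t + 1)) : ℝ) * weightedLegendre n t).eval x =
        -((n - t) * (n + t + 1)) *
          ∫ x in (-1 : ℝ)..1, F (t + 1) x * (weightedLegendre n t).eval x := by
      rw [← intervalIntegral.integral_const_mul]
      congr 1
      ext x
      rw [eval_mul, eval_C]
      ring
    rw [h5]
    field_simp
    ring

/-- The bound on the Legendre coefficients of the derivative of a function. -/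
theorem sq_integral_mul_legendre_le {n t : ℕ} {F : ℕ → ℝ → ℝ} (hF : IsSobolevChain (t + 1) F)
    (h : t ≤ n) :
    (∫ x in (-1 : ℝ)..1, F 1 x * (legendre n).eval x) ^ 2 ≤
      (factRatio n t)⁻¹ * (2 / (2 * n + 1)) * ∫ x in (-1 : ℝ)..1, F (t + 1) x ^ 2 := by
  rw [integral_mul_legendre_eq hF.isPrimitive h, mul_pow]
  have h1 := sq_integral_mul_eval_le (hF.isPrimitive t (by omega)).intervalIntegrable
    hF.integrable_sq (weightedLegendre n t)
  have h2 := integral_weightedLegendre_sq_le h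
  have h3 := factRatio_pos n t
  have h4 : 0 ≤ ∫ x in (-1 : ℝ)..1, F (t + 1) x ^ 2 :=
    intervalIntegral.integral_nonneg (by norm_num) fun x _ => sq_nonneg _
  calc (factRatio n t)⁻¹ ^ 2 *
        (∫ x in (-1 : ℝ)..1, F (t + 1) x * (weightedLegendre n t).eval x) ^ 2
      ≤ (factRatio n t)⁻¹ ^ 2 * ((∫ x in (-1 : ℝ)..1, F (t + 1) x ^ 2) *
          (factRatio n t * (2 / (2 * n + 1)))) := by
        gcongr
        exact h1.trans (by gcongr)
    _ = _ := by field_simp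

theorem degree_derivative_legendre_lt {m n : ℕ} (h : m ≤ n + 1) :
    (derivative (legendre m)).degree < ((n + 1 : ℕ) : WithBot ℕ) := by
  refine degree_derivative_lt_of_degree_lt_succ (degree_le_natDegree.trans_lt ?_)
  have := natDegree_legendre_le m
  exact_mod_cast (by omega : (legendre m).natDegree < n + 1 + 1)

/-- The value of the projection error at `1` involves only two Legendre coefficients of the
derivative. -/
theorem two_mul_error_eval_one {p : ℕ} {f g : ℝ → ℝ} {P : ℝ[X]} (hf : IsPrimitive f g)
    (hP : IsProjDegreeLT (p + 1) f P) :
    2 * (f 1 - P.eval 1) = (∫ x in (-1 : ℝ)..1, g x * (legendre p).eval x) +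
      ∫ x in (-1 : ℝ)..1, g x * (legendre (p + 1)).eval x := by
  have hP' := degree_derivative_lt_of_degree_lt_succ hP.degree_lt
  have key : ∀ m, p ≤ m → m ≤ p + 1 → ∫ x in (-1 : ℝ)..1, g x * (legendre m).eval x =
      (f 1 - P.eval 1) - (f (-1) - P.eval (-1)) * (-1) ^ m := by
    intro m h1 h2
    have h3 := (isPrimitive_eval P).integral_mul_eval (legendre m)
    rw [integral_mul_legendre_eq_zero (hP'.trans_le (by exact_mod_cast h1))] at h3
    rw [hf.integral_mul_eval, hP.integral_mul_eq _ (degree_derivative_legendre_lt h2)]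
    rw [eval_one_legendre, eval_neg_one_legendre] at h3 ⊢
    linarith
  rw [key p le_rfl (by omega), key (p + 1) (by omega) le_rfl, pow_succ]
  ring

theorem sq_error_eval_one_le {p t : ℕ} {F : ℕ → ℝ → ℝ} {P : ℝ[X]} (hp : 0 < p) (ht : t ≤ p)
    (hF : IsSobolevChain (t + 1) F) (hP : IsProjDegreeLT (p + 1) (F 0) P) :
    (F 0 1 - P.eval 1) ^ 2 ≤
      (p : ℝ)⁻¹ * (factRatio p t)⁻¹ * ∫ x in (-1 : ℝ)..1, F (t + 1) x ^ 2 := by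
  have h0 := two_mul_error_eval_one (hF.isPrimitive 0 (by omega)) hP
  have h1 := sq_integral_mul_legendre_le hF ht
  have h2 := sq_integral_mul_legendre_le hF (n := p + 1) (by omega)
  have hS : 0 ≤ ∫ x in (-1 : ℝ)..1, F (t + 1) x ^ 2 :=
    intervalIntegral.integral_nonneg (by norm_num) fun x _ => sq_nonneg _
  have hp' : (0 : ℝ) < p := by exact_mod_cast hp
  have hr := factRatio_pos p t
  have h3 : (2 / (2 * p + 1) : ℝ) ≤ (p : ℝ)⁻¹ := by
    rw [inv_eq_one_div, div_le_div_iff₀ (by positivity) hp']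
    linarith
  have h4 : (2 / (2 * (p + 1 : ℕ) + 1) : ℝ) ≤ (p : ℝ)⁻¹ := by
    rw [inv_eq_one_div, div_le_div_iff₀ (by positivity) hp']
    push_cast
    linarith
  have h5 : (factRatio (p + 1) t)⁻¹ ≤ (factRatio p t)⁻¹ :=
    inv_anti₀ hr (factRatio_mono_left ht)
  simp only [zero_add] at h0
  generalize (∫ x in (-1 : ℝ)..1, F (t + 1) x ^ 2) = S at *
  generalize (∫ x in (-1 : ℝ)..1, F 1 x * (legendre p).eval x) = a at *
  generalize (∫ x in (-1 : ℝ)..1, F 1 x * (legendre (p + 1)).eval x) = b at *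
  have ha : a ^ 2 ≤ (p : ℝ)⁻¹ * (factRatio p t)⁻¹ * S := by
    refine h1.trans ?_
    rw [mul_comm (p : ℝ)⁻¹]
    gcongr
  have hb : b ^ 2 ≤ (p : ℝ)⁻¹ * (factRatio p t)⁻¹ * S := by
    refine h2.trans ?_
    rw [mul_comm (p : ℝ)⁻¹]
    gcongr
  have h6 : F 0 1 - P.eval 1 = (a + b) / 2 := by linarith
  rw [h6]
  nlinarith [sq_nonneg (a - b)]

theorem integral_reflect_sq {f : ℝ → ℝ} (j : ℕ) :
    ∫ x in (-1 : ℝ)..1, ((-1) ^ j * f (-x)) ^ 2 = ∫ x in (-1 : ℝ)..1, f x ^ 2 := by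
  have h := intervalIntegral.integral_comp_neg (a := -1) (b := 1) (fun x => f x ^ 2)
  rw [neg_neg] at h
  rw [← h]
  congr 1
  ext x
  rw [mul_pow, ← pow_mul, mul_comm j, pow_mul]
  norm_num

theorem sq_error_eval_neg_one_le {p t : ℕ} {F : ℕ → ℝ → ℝ} {P : ℝ[X]} (hp : 0 < p) (ht : t ≤ p)
    (hF : IsSobolevChain (t + 1) F) (hP : IsProjDegreeLT (p + 1) (F 0) P) :
    (F 0 (-1) - P.eval (-1)) ^ 2 ≤
      (p : ℝ)⁻¹ * (factRatio p t)⁻¹ * ∫ x in (-1 : ℝ)..1, F (t + 1) x ^ 2 := by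
  have h := sq_error_eval_one_le (P := P.comp (-X)) hp ht hF.reflect (by simpa using hP.reflect)
  rw [integral_reflect_sq] at h
  simpa using h

/-- The polynomial of degree at most `n` that represents evaluation at `1` on the polynomials of
degree at most `n`. -/
noncomputable def evalOneKernel (n : ℕ) : ℝ[X] :=
  C (1 / 2 : ℝ) * (derivative (legendre (n + 1)) + derivative (legendre n))

/-- The polynomial of degree at most `n` that represents evaluation at `-1` on the polynomials of
degree at most `n`. -/
noncomputable def evalNegOneKernel (n : ℕ) : ℝ[X] :=
  C (1 / 2 * (-1) ^ n : ℝ) * (derivative (legendre (n + 1)) - derivative (legendre n))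

theorem integral_derivative_legendre_mul {m : ℕ} {q : ℝ[X]}
    (hq : q.degree < ((m + 1 : ℕ) : WithBot ℕ)) :
    ∫ x in (-1 : ℝ)..1, (derivative (legendre m)).eval x * q.eval x =
      q.eval 1 - (-1) ^ m * q.eval (-1) := by
  have h := integral_mul_legendre_eq_zero (degree_derivative_lt_of_degree_lt_succ hq)
  rw [(isPrimitive_eval _).integral_mul_eval, eval_one_legendre, eval_neg_one_legendre]
  simp_rw [mul_comm ((legendre m).eval _), h]
  ring

theorem integral_evalOneKernel_mul {n : ℕ} {q : ℝ[X]}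
    (hq : q.degree < ((n + 1 : ℕ) : WithBot ℕ)) :
    ∫ x in (-1 : ℝ)..1, (evalOneKernel n).eval x * q.eval x = q.eval 1 := by
  have h1 := integral_derivative_legendre_mul hq
  have h2 := integral_derivative_legendre_mul (m := n + 1)
    (hq.trans (by exact_mod_cast n.succ.lt_succ_self))
  have h3 : ∫ x in (-1 : ℝ)..1, (evalOneKernel n).eval x * q.eval x =
      1 / 2 * ((∫ x in (-1 : ℝ)..1, (derivative (legendre (n + 1))).eval x * q.eval x) +
        ∫ x in (-1 : ℝ)..1, (derivative (legendre n)).eval x * q.eval x) := by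
    rw [← intervalIntegral.integral_add (Continuous.intervalIntegrable (by fun_prop) _ _)
      (Continuous.intervalIntegrable (by fun_prop) _ _), ← intervalIntegral.integral_const_mul]
    congr 1
    ext x
    simp only [evalOneKernel, eval_mul, eval_add, eval_C]
    ring
  rw [h3, h1, h2, pow_succ]
  ring

theorem integral_evalNegOneKernel_mul {n : ℕ} {q : ℝ[X]}
    (hq : q.degree < ((n + 1 : ℕ) : WithBot ℕ)) :
    ∫ x in (-1 : ℝ)..1, (evalNegOneKernel n).eval x * q.eval x = q.eval (-1) := by
  have h1 := integral_derivative_legendre_mul hq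
  have h2 := integral_derivative_legendre_mul (m := n + 1)
    (hq.trans (by exact_mod_cast n.succ.lt_succ_self))
  have h3 : ∫ x in (-1 : ℝ)..1, (evalNegOneKernel n).eval x * q.eval x =
      1 / 2 * (-1) ^ n *
        ((∫ x in (-1 : ℝ)..1, (derivative (legendre (n + 1))).eval x * q.eval x) -
        ∫ x in (-1 : ℝ)..1, (derivative (legendre n)).eval x * q.eval x) := by
    rw [← intervalIntegral.integral_sub (Continuous.intervalIntegrable (by fun_prop) _ _)
      (Continuous.intervalIntegrable (by fun_prop) _ _), ← intervalIntegral.integral_const_mul]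
    congr 1
    ext x
    simp only [evalNegOneKernel, eval_mul, eval_sub, eval_C]
    ring
  have h4 : ((-1 : ℝ) ^ n) * (-1) ^ n = 1 := by rw [← mul_pow]; norm_num
  rw [h3, h1, h2, pow_succ]
  linear_combination (q.eval (-1)) * h4

/-- Differentiation almost commutes with projection: the two differ by the kernels of the endpoint
evaluations, weighted by the endpoint errors. -/
protected theorem IsProjDegreeLT.derivative {n : ℕ} {f g : ℝ → ℝ} {P : ℝ[X]} (hf : IsPrimitive f g)
    (hP : IsProjDegreeLT (n + 2) f P) :
    IsProjDegreeLT (n + 1) g (derivative P +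
      C (f 1 - P.eval 1) * evalOneKernel n - C (f (-1) - P.eval (-1)) * evalNegOneKernel n) := by
  have hd : ∀ m ≤ n + 1, (derivative (legendre m)) ∈ degreeLT ℝ (n + 1) :=
    fun m hm => mem_degreeLT.2 (degree_derivative_legendre_lt hm)
  refine ⟨?_, fun v hv => ?_⟩
  · rw [← mem_degreeLT]
    refine sub_mem (add_mem (mem_degreeLT.2 (degree_derivative_lt_of_degree_lt_succ hP.degree_lt))
      ?_) ?_
    · simp only [evalOneKernel, ← smul_eq_C_mul]
      exact Submodule.smul_mem _ _ (Submodule.smul_mem _ _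
        (add_mem (hd _ le_rfl) (hd _ (by omega))))
    · simp only [evalNegOneKernel, ← smul_eq_C_mul]
      exact Submodule.smul_mem _ _ (Submodule.smul_mem _ _
        (sub_mem (hd _ le_rfl) (hd _ (by omega))))
  · have h1 := integral_evalOneKernel_mul hv
    have h2 := integral_evalNegOneKernel_mul hv
    have h3 := (isPrimitive_eval P).integral_mul_eval v
    have h4 := hP.integral_mul_eq (derivative v)
      ((degree_derivative_lt_of_degree_lt_succ hv).trans
        (by exact_mod_cast (by omega : n < n + 2)))
    have h5 : ∫ x in (-1 : ℝ)..1, (derivative P + C (f 1 - P.eval 1) * evalOneKernel n -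
        C (f (-1) - P.eval (-1)) * evalNegOneKernel n).eval x * v.eval x =
        (∫ x in (-1 : ℝ)..1, (derivative P).eval x * v.eval x) +
        (f 1 - P.eval 1) * (∫ x in (-1 : ℝ)..1, (evalOneKernel n).eval x * v.eval x) -
        (f (-1) - P.eval (-1)) * ∫ x in (-1 : ℝ)..1, (evalNegOneKernel n).eval x * v.eval x := by
      rw [← intervalIntegral.integral_const_mul, ← intervalIntegral.integral_const_mul,
        ← intervalIntegral.integral_add (Continuous.intervalIntegrable (by fun_prop) _ _)
        (Continuous.intervalIntegrable (by fun_prop) _ _),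
        ← intervalIntegral.integral_sub (Continuous.intervalIntegrable (by fun_prop) _ _)
        (Continuous.intervalIntegrable (by fun_prop) _ _)]
      congr 1
      ext x
      simp only [eval_add, eval_sub, eval_mul, eval_C]
      ring
    rw [h5, h1, h2, h3, hf.integral_mul_eval, h4]
    ring

theorem sq_eval_one_kernels_le {n ν : ℕ} (h : ν < n) :
    (derivative^[ν] (evalOneKernel n)).eval 1 ^ 2 ≤ factRatio (n + 1) (ν + 1) ^ 2 ∧
      (derivative^[ν] (evalNegOneKernel n)).eval 1 ^ 2 ≤ factRatio (n + 1) (ν + 1) ^ 2 := by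
  have h1 := eval_one_iterate_derivative_legendre_nonneg (n := n) (t := ν + 1) h
  have h2 := eval_one_iterate_derivative_legendre_mono (n := n) (t := ν + 1) h
  have h3 := eval_one_iterate_derivative_legendre_le (n := n + 1) (t := ν + 1) (by omega)
  have h4 : ((-1 : ℝ) ^ n) ^ 2 = 1 := by rw [← pow_mul, mul_comm, pow_mul]; norm_num
  simp only [evalOneKernel, evalNegOneKernel, iterate_derivative_C_mul, iterate_map_add,
    iterate_derivative_sub, ← Function.iterate_succ_apply, eval_mul, eval_C, eval_add, eval_sub,
    mul_pow, Nat.succ_eq_add_one, h4]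
  generalize (derivative^[ν + 1] (legendre n)).eval 1 = a at *
  generalize (derivative^[ν + 1] (legendre (n + 1))).eval 1 = b at *
  constructor <;> nlinarith

/-- The endpoint bound at `1`, by induction on the order `ν` of the derivative. -/
theorem sq_error_iterate_derivative_eval_one_le (ν : ℕ) : ∀ (p s : ℕ) (F : ℕ → ℝ → ℝ) (P : ℝ[X]),
    ν < p → s ≤ p - ν → IsSobolevChain (s + ν + 1) F → IsProjDegreeLT (p + 1) (F 0) P →
    (F ν 1 - (derivative^[ν] P).eval 1) ^ 2 ≤
      144 * ((p : ℝ) ^ (2 * ν) * (p : ℝ)⁻¹) * (factRatio (p - ν) s)⁻¹ *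
        ∫ x in (-1 : ℝ)..1, F (s + ν + 1) x ^ 2 := by
  induction ν with
  | zero =>
    intro p s F P hp hs hF hP
    have h := sq_error_eval_one_le hp hs hF hP
    have hp' : (0 : ℝ) < p := by exact_mod_cast hp
    have hr := factRatio_pos p s
    have hS : 0 ≤ ∫ x in (-1 : ℝ)..1, F (s + 1) x ^ 2 :=
      intervalIntegral.integral_nonneg (by norm_num) fun x _ => sq_nonneg _
    have h0 : 0 ≤ (p : ℝ)⁻¹ * (factRatio p s)⁻¹ * ∫ x in (-1 : ℝ)..1, F (s + 1) x ^ 2 := by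
      positivity
    simp only [Function.iterate_zero, id, Nat.sub_zero, add_zero, mul_zero, pow_zero, one_mul]
    linarith
  | succ ν ih =>
    intro p s F P hp hs hF hP
    obtain ⟨n, rfl⟩ : ∃ n, p = n + 1 := ⟨p - 1, by omega⟩
    have hG : IsSobolevChain (s + ν + 1) (fun j => F (j + 1)) :=
      ⟨fun j hj => hF.isPrimitive (j + 1) (by omega), hF.integrable_sq⟩
    have hQ := hP.derivative (hF.isPrimitive 0 (by omega))
    have h1 := ih n s _ _ (by omega) (by omega) hG hQ
    have hF' : IsSobolevChain (ν + 1 + s + 1) F := by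
      convert hF using 1
      ring
    have h2 := sq_error_eval_one_le (by omega) (by omega) hF' hP
    have h3 := sq_error_eval_neg_one_le (by omega) (by omega) hF' hP
    obtain ⟨h4, h5⟩ := sq_eval_one_kernels_le (n := n) (ν := ν) (by omega)
    have h6 := factRatio_le (p := n + 1) (ν := ν + 1) (by omega)
    have h7 := factRatio_mul_le (p := n + 1) (ν := ν + 1) (s := s) (by omega) hs
    have h8 := factRatio_pos (n + 1) (ν + 1)
    have h9 := factRatio_pos (n + 1) (ν + 1 + s)
    have h10 := factRatio_pos (n + 1 - (ν + 1)) s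
    have hS : 0 ≤ ∫ x in (-1 : ℝ)..1, F (s + (ν + 1) + 1) x ^ 2 :=
      intervalIntegral.integral_nonneg (by norm_num) fun x _ => sq_nonneg _
    have e1 : ν + 1 + s + 1 = s + (ν + 1) + 1 := by ring
    have e2 : s + ν + 1 + 1 = s + (ν + 1) + 1 := by ring
    have e3 : n - ν = n + 1 - (ν + 1) := by omega
    simp only [iterate_derivative_sub, iterate_map_add, iterate_derivative_C_mul,
      ← Function.iterate_succ_apply, Nat.succ_eq_add_one, eval_sub, eval_add, eval_mul, eval_C,
      e2, e3] at h1
    rw [e1] at h2 h3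
    set q : ℝ := ((n + 1 : ℕ) : ℝ) with hq
    have hn : (1 : ℝ) ≤ n := by exact_mod_cast (by omega : 1 ≤ n)
    have hqn : q = n + 1 := by rw [hq]; push_cast; ring
    have hq0 : 0 < q := by linarith
    generalize (∫ x in (-1 : ℝ)..1, F (s + (ν + 1) + 1) x ^ 2) = S at *
    generalize factRatio (n + 1) (ν + 1) = r at *
    generalize factRatio (n + 1) (ν + 1 + s) = R at *
    generalize factRatio (n + 1 - (ν + 1)) s = f at *
    generalize (derivative^[ν] (evalOneKernel n)).eval 1 = α at *
    generalize (derivative^[ν] (evalNegOneKernel n)).eval 1 = β at *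
    generalize F 0 1 - P.eval 1 = a at *
    generalize F 0 (-1) - P.eval (-1) = b at *
    generalize (derivative^[ν + 1] P).eval 1 = y at *
    generalize F (ν + 1) 1 = z at *
    -- The weight of the inductive bound at degree `n` is at most half of the weight at `n + 1`.
    have k1 : (n : ℝ) ^ (2 * ν) * (n : ℝ)⁻¹ ≤ 1 / 2 * (q ^ (2 * (ν + 1)) * q⁻¹) := by
      have : q ^ (2 * (ν + 1)) * q⁻¹ = q ^ (2 * ν) * q := by
        rw [mul_add, pow_add]; field_simp
      rw [this, mul_left_comm]
      have : (n : ℝ)⁻¹ ≤ 1 / 2 * q := by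
        rw [inv_eq_one_div, div_le_iff₀ (by linarith)]
        nlinarith
      have : (n : ℝ) ≤ q := by linarith
      gcongr
    have k2 : r ^ 2 * (q⁻¹ * R⁻¹ * S) ≤ 3 * (q ^ (2 * (ν + 1)) * q⁻¹) * f⁻¹ * S := by
      have : r * R⁻¹ ≤ f⁻¹ := by
        rw [← div_eq_mul_inv, div_le_iff₀ h9, inv_mul_eq_div, le_div_iff₀ h10]
        exact h7
      calc r ^ 2 * (q⁻¹ * R⁻¹ * S) = r * q⁻¹ * (r * R⁻¹) * S := by ring
        _ ≤ (3 * q ^ (2 * (ν + 1))) * q⁻¹ * f⁻¹ * S := by gcongr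
        _ = _ := by ring
    have k3 : (a * α) ^ 2 ≤ 3 * (q ^ (2 * (ν + 1)) * q⁻¹) * f⁻¹ * S := by
      refine le_trans ?_ k2
      rw [mul_pow, mul_comm]
      gcongr
    have k4 : (b * β) ^ 2 ≤ 3 * (q ^ (2 * (ν + 1)) * q⁻¹) * f⁻¹ * S := by
      refine le_trans ?_ k2
      rw [mul_pow, mul_comm]
      gcongr
    have k5 : (z - (y + a * α - b * β)) ^ 2 ≤
        144 * (1 / 2 * (q ^ (2 * (ν + 1)) * q⁻¹)) * f⁻¹ * S := by
      refine h1.trans ?_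
      gcongr
    -- Young's inequality, with most of the weight on the terms outside the inductive bound.
    have k6 : (z - y) ^ 2 ≤ 4 / 3 * (z - (y + a * α - b * β)) ^ 2 +
        8 * (a * α) ^ 2 + 8 * (b * β) ^ 2 := by
      nlinarith [sq_nonneg (z - (y + a * α - b * β) - 3 * (a * α - b * β)),
        sq_nonneg (a * α + b * β)]
    linarith

/-- The endpoint bound at `-1`, by reflection. -/
theorem sq_error_iterate_derivative_eval_neg_one_le {ν p s : ℕ} {F : ℕ → ℝ → ℝ} {P : ℝ[X]}
    (hp : ν < p) (hs : s ≤ p - ν) (hF : IsSobolevChain (s + ν + 1) F)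
    (hP : IsProjDegreeLT (p + 1) (F 0) P) :
    (F ν (-1) - (derivative^[ν] P).eval (-1)) ^ 2 ≤
      144 * ((p : ℝ) ^ (2 * ν) * (p : ℝ)⁻¹) * (factRatio (p - ν) s)⁻¹ *
        ∫ x in (-1 : ℝ)..1, F (s + ν + 1) x ^ 2 := by
  have h := sq_error_iterate_derivative_eval_one_le ν p s _ (P.comp (-X)) hp hs hF.reflect
    (by simpa using hP.reflect)
  rw [integral_reflect_sq, iterate_derivative_comp_neg_X] at h
  simp only [eval_mul, eval_C, eval_comp, eval_neg, eval_X, ← mul_sub, mul_pow] at h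
  rwa [← pow_mul, mul_comm ν, pow_mul, neg_one_sq, one_pow, one_mul] at h

/-! ### Weak derivatives on the interval -/

theorem integral_Ω_eq (f : ℝ → ℝ) : ∫ x in Ω, f x = ∫ x in (-1 : ℝ)..1, f x := by
  rw [intervalIntegral.integral_of_le (by norm_num), integral_Ioc_eq_integral_Ioo, Ω]

theorem intervalIntegrable_iff_integrable_μΩ {f : ℝ → ℝ} :
    IntervalIntegrable f volume (-1) 1 ↔ Integrable f μΩ := by
  rw [intervalIntegrable_iff_integrableOn_Ioo_of_le (by norm_num)]
  rfl

protected theorem IsTest.iteratedDeriv {φ : ℝ → ℝ} (h : IsTest φ) (j : ℕ) :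
    IsTest (iteratedDeriv j φ) := by
  induction j with
  | zero => simpa using h
  | succ j ih =>
    rw [iteratedDeriv_succ]
    obtain ⟨h1, h2, h3⟩ := ih
    exact ⟨((contDiff_infty_iff_deriv).1 h1).2, h2.deriv, (tsupport_deriv_subset).trans h3⟩

protected theorem IsTest.deriv {φ : ℝ → ℝ} (h : IsTest φ) : IsTest (deriv φ) := by
  simpa using h.iteratedDeriv 1

theorem IsTest.eq_zero_of_notMem {φ : ℝ → ℝ} (h : IsTest φ) {x : ℝ} (hx : x ∉ Ω) : φ x = 0 :=
  image_eq_zero_of_notMem_tsupport fun h' => hx (h.2.2 h')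

theorem IsPrimitive.integral_mul_deriv_test {f g φ : ℝ → ℝ} (h : IsPrimitive f g)
    (hφ : IsTest φ) : ∫ x in Ω, f x * deriv φ x = -∫ x in Ω, g x * φ x := by
  rw [integral_Ω_eq, integral_Ω_eq, h.integral_mul (hφ.1.of_le (by simp)),
    hφ.eq_zero_of_notMem (x := 1) (by simp [Ω]), hφ.eq_zero_of_notMem (x := -1) (by simp [Ω])]
  ring

theorem isWeakDeriv_eval (P : ℝ[X]) (j : ℕ) :
    IsWeakDeriv j (fun x => P.eval x) (fun x => (derivative^[j] P).eval x) := by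
  refine ⟨P.continuous.locallyIntegrable.locallyIntegrableOn _,
    (derivative^[j] P).continuous.locallyIntegrable.locallyIntegrableOn _, ?_⟩
  induction j with
  | zero => intro φ _; simp
  | succ j ih =>
    intro φ hφ
    rw [iteratedDeriv_succ', ih _ hφ.deriv, (isPrimitive_eval _).integral_mul_deriv_test hφ,
      Function.iterate_succ_apply', pow_succ]
    ring

theorem integrable_mul_test {f φ : ℝ → ℝ} (hf : LocallyIntegrableOn f Ω) (hφ : IsTest φ) :
    IntegrableOn (fun x => f x * φ x) Ω := by
  have h1 : IntegrableOn f (tsupport φ) := hf.integrableOn_compact_subset hφ.2.2 hφ.2.1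
  have h2 : IntegrableOn (fun x => f x * φ x) (tsupport φ) :=
    h1.mul_continuousOn hφ.1.continuous.continuousOn hφ.2.1
  have h3 : Integrable (fun x => f x * φ x) := by
    rw [← integrableOn_iff_integrable_of_support_subset (s := tsupport φ)]
    · exact h2
    · exact (Function.support_mul_subset_right _ _).trans (subset_tsupport _)
  exact h3.integrableOn

/-- The fundamental lemma of the calculus of variations on `Ω`. -/
theorem ae_eq_zero_of_integral_mul_test {f : ℝ → ℝ} (hf : LocallyIntegrableOn f Ω)
    (h : ∀ φ, IsTest φ → ∫ x in Ω, f x * φ x = 0) : f =ᵐ[μΩ] 0 := by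
  have h1 := (isOpen_Ioo : IsOpen Ω).ae_eq_zero_of_integral_contDiff_smul_eq_zero hf
    fun φ h1 h2 h3 => by
      rw [← h φ ⟨h1, h2, h3⟩, setIntegral_eq_integral_of_forall_compl_eq_zero]
      · simp only [smul_eq_mul, mul_comm]
      · intro x hx
        rw [IsTest.eq_zero_of_notMem ⟨h1, h2, h3⟩ hx, mul_zero]
  exact (ae_restrict_iff' measurableSet_Ioo).2 h1

theorem IsWeakDeriv.ae_eq {j : ℕ} {w g h : ℝ → ℝ} (hg : IsWeakDeriv j w g)
    (hh : IsWeakDeriv j w h) : g =ᵐ[μΩ] h := by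
  have h1 : (fun x => g x - h x) =ᵐ[μΩ] 0 := by
    refine ae_eq_zero_of_integral_mul_test (hg.2.1.sub hh.2.1) fun φ hφ => ?_
    have h2 := (hg.2.2 φ hφ).symm.trans (hh.2.2 φ hφ)
    have h3 : ((-1 : ℝ) ^ j) ≠ 0 := by positivity
    simp only [sub_mul]
    rw [integral_sub (integrable_mul_test hg.2.1 hφ) (integrable_mul_test hh.2.1 hφ),
      mul_left_cancel₀ h3 h2, sub_self]
  filter_upwards [h1] with x hx
  exact sub_eq_zero.1 hx

/-- A test function of integral zero is the derivative of a test function. -/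
theorem IsTest.exists_deriv_eq {φ : ℝ → ℝ} (hφ : IsTest φ) (h0 : ∫ x in Ω, φ x = 0) :
    ∃ χ, IsTest χ ∧ deriv χ = φ := by
  have hd : ∀ x, HasDerivAt (fun x => ∫ t in (-1 : ℝ)..x, φ t) (φ x) x := fun x =>
    intervalIntegral.integral_hasDerivAt_right (hφ.1.continuous.intervalIntegrable _ _)
      (hφ.1.continuous.stronglyMeasurableAtFilter _ _) hφ.1.continuous.continuousAt
  have hderiv : deriv (fun x => ∫ t in (-1 : ℝ)..x, φ t) = φ := funext fun x => (hd x).deriv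
  rw [integral_Ω_eq] at h0
  -- A compact subinterval of `Ω` that contains the support of `φ`.
  obtain ⟨a, b, ha, hb, hab⟩ : ∃ a b : ℝ, -1 < a ∧ b < 1 ∧ tsupport φ ⊆ Icc a b := by
    rcases (tsupport φ).eq_empty_or_nonempty with h | h
    · exact ⟨0, 0, by norm_num, by norm_num, by simp [h]⟩
    · obtain ⟨a, ha⟩ := hφ.2.1.exists_isLeast h
      obtain ⟨b, hb⟩ := hφ.2.1.exists_isGreatest h
      exact ⟨a, b, (hφ.2.2 ha.1).1, (hφ.2.2 hb.1).2, fun x hx => ⟨ha.2 hx, hb.2 hx⟩⟩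
  have hz : ∀ x, x ∉ Icc a b → φ x = 0 := fun x hx =>
    image_eq_zero_of_notMem_tsupport fun h => hx (hab h)
  have hsupp : Function.support (fun x => ∫ t in (-1 : ℝ)..x, φ t) ⊆ Icc a b := by
    intro x hx
    by_contra hx'
    apply hx
    rw [mem_Icc, not_and_or, not_le, not_le] at hx'
    simp only
    rcases hx' with h | h
    · refine intervalIntegral.integral_zero_ae (ae_of_all _ fun t ht => hz t fun ht' => ?_)
      have := ht.2
      exact absurd ht'.1 (not_le.2 (this.trans_lt (max_lt ha h)))
    · have e := intervalIntegral.integral_add_adjacent_intervals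
        (hφ.1.continuous.intervalIntegrable (μ := volume) (-1) 1)
        (hφ.1.continuous.intervalIntegrable 1 x)
      rw [← e, h0, zero_add]
      refine intervalIntegral.integral_zero_ae (ae_of_all _ fun t ht => hz t fun ht' => ?_)
      have := ht.1
      exact absurd ht'.2 (not_le.2 ((lt_min hb h).trans this))
  have hts := closure_minimal hsupp isClosed_Icc
  refine ⟨_, ⟨?_, HasCompactSupport.of_support_subset_isCompact isCompact_Icc hsupp, ?_⟩, hderiv⟩
  · rw [contDiff_infty_iff_deriv]
    exact ⟨fun x => (hd x).differentiableAt, by rw [hderiv]; exact hφ.1⟩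
  · exact hts.trans (Icc_subset_Ioo ha hb)

theorem exists_isTest_integral_eq_one : ∃ θ, IsTest θ ∧ ∫ x in Ω, θ x = 1 := by
  obtain ⟨f, h1, h2, h3, h4, h5⟩ := exists_contDiff_tsupport_subset (n := ⊤)
    ((isOpen_Ioo : IsOpen Ω).mem_nhds (show (0 : ℝ) ∈ Ω by simp [Ω]))
  have hpos : 0 < ∫ x, f x :=
    h3.continuous.integral_pos_of_hasCompactSupport_nonneg_nonzero h2
      (fun x => (h4 (mem_range_self x)).1) (by rw [h5]; norm_num : f 0 ≠ 0)
  have hf : IsTest f := ⟨h3, h2, h1⟩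
  have hΩ : ∫ x in Ω, f x = ∫ x, f x :=
    setIntegral_eq_integral_of_forall_compl_eq_zero fun x hx => hf.eq_zero_of_notMem hx
  refine ⟨fun x => (∫ x, f x)⁻¹ * f x, ⟨contDiff_const.mul h3, h2.mul_left,
    (tsupport_mul_subset_right).trans h1⟩, ?_⟩
  rw [integral_const_mul, hΩ, inv_mul_cancel₀ hpos.ne']

/-- The du Bois-Reymond lemma: a function with weak derivative zero is constant. -/
theorem ae_eq_const_of_integral_mul_deriv {f : ℝ → ℝ} (hf : LocallyIntegrableOn f Ω)
    (h : ∀ φ, IsTest φ → ∫ x in Ω, f x * deriv φ x = 0) : ∃ c : ℝ, f =ᵐ[μΩ] fun _ => c := by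
  obtain ⟨θ, hθ, hθ1⟩ := exists_isTest_integral_eq_one
  have hi : ∀ φ, IsTest φ → IntegrableOn φ Ω := fun φ hφ =>
    (hφ.1.continuous.integrable_of_hasCompactSupport hφ.2.1).integrableOn
  have hc : LocallyIntegrableOn (fun _ : ℝ => ∫ x in Ω, f x * θ x) Ω :=
    (locallyIntegrable_const _).locallyIntegrableOn _
  refine ⟨∫ x in Ω, f x * θ x, ?_⟩
  have key : (fun x => f x - ∫ x in Ω, f x * θ x) =ᵐ[μΩ] 0 := by
    refine ae_eq_zero_of_integral_mul_test (hf.sub hc) fun φ hφ => ?_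
    -- Subtracting the right multiple of `θ` makes the integral of the test function vanish.
    have hψ : IsTest (fun x => φ x - (∫ x in Ω, φ x) * θ x) :=
      ⟨hφ.1.sub (contDiff_const.mul hθ.1), hφ.2.1.sub hθ.2.1.mul_left,
        (tsupport_sub _ _).trans
          (union_subset hφ.2.2 ((tsupport_mul_subset_right).trans hθ.2.2))⟩
    obtain ⟨χ, hχ, hχ'⟩ := hψ.exists_deriv_eq (by
      rw [integral_sub (hi φ hφ) ((hi θ hθ).const_mul _), integral_const_mul, hθ1]
      ring)
    have h1 := h χ hχ
    rw [hχ'] at h1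
    have e : ∀ x, f x * (φ x - (∫ x in Ω, φ x) * θ x) =
        f x * φ x - (∫ x in Ω, φ x) * (f x * θ x) := fun x => by ring
    simp only [e] at h1
    rw [integral_sub (integrable_mul_test hf hφ) ((integrable_mul_test hf hθ).const_mul _),
      integral_const_mul] at h1
    simp only [sub_mul]
    rw [integral_sub (integrable_mul_test hf hφ) (integrable_mul_test hc hφ), integral_const_mul]
    linarith
  filter_upwards [key] with x hx
  exact sub_eq_zero.1 hx

theorem isPrimitive_integral {g : ℝ → ℝ} (hg : IntervalIntegrable g volume (-1) 1) (c : ℝ) :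
    IsPrimitive (fun x => c + ∫ t in (-1 : ℝ)..x, g t) g :=
  ⟨hg, fun x _ => by simp⟩

theorem locallyIntegrableOn_of_intervalIntegrable {f : ℝ → ℝ}
    (hf : IntervalIntegrable f volume (-1) 1) : LocallyIntegrableOn f Ω :=
  IntegrableOn.locallyIntegrableOn (intervalIntegrable_iff_integrable_μΩ.1 hf)

/-- A function with an integrable weak derivative agrees almost everywhere with a primitive of
that derivative. -/
theorem exists_ae_eq_add_integral {f g : ℝ → ℝ} (hf : LocallyIntegrableOn f Ω)
    (hg : IntervalIntegrable g volume (-1) 1)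
    (h : ∀ φ, IsTest φ → ∫ x in Ω, f x * deriv φ x = -∫ x in Ω, g x * φ x) :
    ∃ c : ℝ, f =ᵐ[μΩ] fun x => c + ∫ t in (-1 : ℝ)..x, g t := by
  have hp := isPrimitive_integral hg 0
  have hG := locallyIntegrableOn_of_intervalIntegrable hp.intervalIntegrable_left
  obtain ⟨c, hc⟩ := ae_eq_const_of_integral_mul_deriv (hf.sub hG) fun φ hφ => by
    simp only [Pi.sub_apply, sub_mul]
    rw [integral_sub (integrable_mul_test hf hφ.deriv) (integrable_mul_test hG hφ.deriv), h φ hφ,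
      hp.integral_mul_deriv_test hφ, sub_self]
  refine ⟨c, ?_⟩
  filter_upwards [hc] with x hx
  simp only [Pi.sub_apply] at hx
  linarith

/-! ### Sobolev functions and the projection error -/

theorem MemH.weakDeriv_spec {k j : ℕ} {w : ℝ → ℝ} (h : MemH k w) (hj : j ≤ k) :
    MemLp (weakDeriv j w) 2 μΩ ∧ IsWeakDeriv j w (weakDeriv j w) := by
  have := h.2 j hj
  rw [weakDeriv, dif_pos this]
  exact this.choose_spec

instance : IsFiniteMeasure μΩ := by
  unfold μΩ Ω
  infer_instance

/-- Functions in `H^m` have representatives whose derivatives up to order `m - 1` are absolutely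
continuous. -/
theorem MemH.exists_isSobolevChain {m : ℕ} {w : ℝ → ℝ} (h : MemH m w) :
    ∃ F : ℕ → ℝ → ℝ, IsSobolevChain m F ∧ ∀ j ≤ m, weakDeriv j w =ᵐ[μΩ] F j := by
  have hint : ∀ j ≤ m, IntervalIntegrable (weakDeriv j w) volume (-1) 1 := fun j hj =>
    intervalIntegrable_iff_integrable_μΩ.2 ((h.weakDeriv_spec hj).1.integrable (by norm_num))
  have step : ∀ j, ∃ c : ℝ, j < m →
      weakDeriv j w =ᵐ[μΩ] fun x => c + ∫ t in (-1 : ℝ)..x, weakDeriv (j + 1) w t := by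
    intro j
    by_cases hj : j < m
    · obtain ⟨c, hc⟩ := exists_ae_eq_add_integral (h.weakDeriv_spec hj.le).2.2.1
        (hint (j + 1) hj) fun φ hφ => by
          have h1 := (h.weakDeriv_spec hj.le).2.2.2 _ hφ.deriv
          rw [← iteratedDeriv_succ', (h.weakDeriv_spec (show j + 1 ≤ m from hj)).2.2.2 _ hφ,
            pow_succ, mul_assoc] at h1
          rw [← mul_left_cancel₀ (by positivity) h1]
          ring
      exact ⟨c, fun _ => hc⟩
    · exact ⟨0, fun h => absurd h hj⟩
  choose c hc using step
  let F : ℕ → ℝ → ℝ := fun j => if j < m then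
    fun x => c j + ∫ t in (-1 : ℝ)..x, weakDeriv (j + 1) w t else weakDeriv j w
  have hF : ∀ j ≤ m, weakDeriv j w =ᵐ[μΩ] F j := by
    intro j hj
    by_cases hj' : j < m
    · simpa only [F, if_pos hj'] using hc j hj'
    · simp only [F, if_neg hj']
      exact Filter.EventuallyEq.rfl
  have hFI : ∀ j ≤ m, IntervalIntegrable (F j) volume (-1) 1 := fun j hj =>
    intervalIntegrable_iff_integrable_μΩ.2
      ((intervalIntegrable_iff_integrable_μΩ.1 (hint j hj)).congr (hF j hj))
  refine ⟨F, ⟨fun j hj => ⟨hFI (j + 1) hj, fun x hx => ?_⟩, ?_⟩, hF⟩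
  · simp only [F, if_pos hj, intervalIntegral.integral_same, add_zero]
    congr 1
    have h1 : weakDeriv (j + 1) w =ᵐ[volume.restrict (Ioo (-1) x)] F (j + 1) :=
      ae_restrict_of_ae_restrict_of_subset (Ioo_subset_Ioo_right hx.2) (hF (j + 1) hj)
    rw [intervalIntegral.integral_of_le hx.1, intervalIntegral.integral_of_le hx.1,
      integral_Ioc_eq_integral_Ioo, integral_Ioc_eq_integral_Ioo]
    exact integral_congr_ae h1
  · rw [intervalIntegrable_iff_integrable_μΩ]
    exact (((memLp_congr_ae (hF m le_rfl)).1 (h.weakDeriv_spec le_rfl).1)).integrable_sq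

theorem MemH.mono {m k : ℕ} {w : ℝ → ℝ} (h : MemH k w) (hm : m ≤ k) : MemH m w :=
  ⟨h.1, fun j hj => h.2 j (hj.trans hm)⟩

theorem IsWeakDeriv.congr_ae {j : ℕ} {w g h : ℝ → ℝ} (hg : IsWeakDeriv j w g)
    (hh : LocallyIntegrableOn h Ω) (hgh : g =ᵐ[μΩ] h) : IsWeakDeriv j w h := by
  refine ⟨hg.1, hh, fun φ hφ => ?_⟩
  rw [hg.2.2 φ hφ]
  congr 1
  apply integral_congr_ae
  filter_upwards [hgh] with x hx
  rw [hx]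

theorem IsWeakDeriv.sub {j : ℕ} {w₁ w₂ g₁ g₂ : ℝ → ℝ} (h₁ : IsWeakDeriv j w₁ g₁)
    (h₂ : IsWeakDeriv j w₂ g₂) :
    IsWeakDeriv j (fun x => w₁ x - w₂ x) (fun x => g₁ x - g₂ x) := by
  refine ⟨h₁.1.sub h₂.1, h₁.2.1.sub h₂.2.1, fun φ hφ => ?_⟩
  simp only [sub_mul]
  rw [integral_sub (integrable_mul_test h₁.1 (hφ.iteratedDeriv j))
      (integrable_mul_test h₂.1 (hφ.iteratedDeriv j)),
    integral_sub (integrable_mul_test h₁.2.1 hφ) (integrable_mul_test h₂.2.1 hφ),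
    h₁.2.2 φ hφ, h₂.2.2 φ hφ, mul_sub]

theorem IsContDerivRep.eqOn {ν : ℕ} {e u v : ℝ → ℝ} (hu : IsContDerivRep ν e u)
    (hv : IsContDerivRep ν e v) : EqOn u v (Icc (-1) 1) := by
  have h1 : EqOn u v (Ioo (-1) 1) := Measure.eqOn_open_of_ae_eq (hu.2.ae_eq hv.2) isOpen_Ioo
    (hu.1.mono Ioo_subset_Icc_self) (hv.1.mono Ioo_subset_Icc_self)
  exact h1.of_subset_closure hu.1 hv.1 Ioo_subset_Icc_self (by rw [closure_Ioo (by norm_num)])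

/-- The derivatives of the projection error have explicit continuous representatives. -/
theorem isContDerivRep_projError {p ν m : ℕ} {w : ℝ → ℝ} {F : ℕ → ℝ → ℝ} (h : MemH m w)
    (hF : IsSobolevChain m F) (hw : ∀ j ≤ m, weakDeriv j w =ᵐ[μΩ] F j) (hν : ν < m) :
    IsContDerivRep ν (projError p w)
      (fun x => F ν x - (derivative^[ν] (l2Proj p w)).eval x) := by
  refine ⟨(hF.isPrimitive ν hν).continuousOn.sub (Polynomial.continuousOn _), ?_⟩
  refine IsWeakDeriv.sub ?_ (isWeakDeriv_eval _ ν)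
  exact (h.weakDeriv_spec hν.le).2.congr_ae (locallyIntegrableOn_of_intervalIntegrable
    (hF.isPrimitive ν hν).intervalIntegrable_left) (hw ν hν.le)

theorem isWeakDeriv_zero {w : ℝ → ℝ} (hw : LocallyIntegrableOn w Ω) : IsWeakDeriv 0 w w :=
  ⟨hw, hw, fun φ _ => by simp⟩

theorem isProjDegreeLT_l2Proj {p : ℕ} {w f : ℝ → ℝ} (hw : MemLp w 2 μΩ) (hf : w =ᵐ[μΩ] f) :
    IsProjDegreeLT (p + 1) f (l2Proj p w) := by
  obtain ⟨h1, h2⟩ := l2Proj_spec p hw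
  have hdeg : ∀ q : ℝ[X], q.degree < ((p + 1 : ℕ) : WithBot ℕ) ↔ q ∈ degreeLE ℝ p := by
    intro q
    rw [mem_degreeLE, degree_lt_iff_coeff_zero, degree_le_iff_coeff_zero]
    simp
  refine ⟨(hdeg _).2 h1, fun v hv => ?_⟩
  have h3 := h2 v ((hdeg v).1 hv)
  have h4 : Integrable (fun x => (l2Proj p w).eval x * v.eval x) μΩ := by
    simpa using integrable_eval (l2Proj p w * v)
  simp only [sub_mul] at h3
  change ∫ x, _ ∂μΩ = 0 at h3
  rw [integral_sub h4 (integrable_mul_eval hw v), sub_eq_zero] at h3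
  rw [← integral_Ω_eq, ← integral_Ω_eq]
  refine Eq.trans ?_ h3.symm
  apply integral_congr_ae
  filter_upwards [hf] with x hx
  rw [hx]

end LegendreTrace

theorem mainTheorem3 :
    ∃ C : ℝ, 0 < C ∧
      ∀ (ν p k s : ℕ) (w : ℝ → ℝ),
        ν < p → s ≤ p - ν → s + ν + 1 ≤ k → LegendreTrace.MemH k w →
          (∃ u : ℝ → ℝ, LegendreTrace.IsContDerivRep ν (LegendreTrace.projError p w) u) ∧
          ∀ u : ℝ → ℝ, LegendreTrace.IsContDerivRep ν (LegendreTrace.projError p w) u →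
            ∀ x ∈ ({1, -1} : Set ℝ),
              |u x| ^ 2 ≤
                C * (p : ℝ) ^ (2 * (ν : ℤ) - 1) *
                  (((p - ν - s).factorial : ℝ) / ((p - ν + s).factorial : ℝ)) *
                  LegendreTrace.seminormH (s + ν + 1) w ^ 2 := by
  open LegendreTrace in
  refine ⟨144, by norm_num, fun ν p k s w hν hs hk hw => ?_⟩
  have hm := hw.mono hk
  obtain ⟨F, hF, hwF⟩ := hm.exists_isSobolevChain
  have hrep := isContDerivRep_projError (p := p) hm hF hwF (by omega : ν < s + ν + 1)
  refine ⟨⟨_, hrep⟩, fun u hu x hx => ?_⟩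
  have hP : IsProjDegreeLT (p + 1) (F 0) (l2Proj p w) :=
    isProjDegreeLT_l2Proj hw.1 (((isWeakDeriv_zero (hm.weakDeriv_spec (Nat.zero_le _)).2.1).ae_eq
      (hm.weakDeriv_spec (Nat.zero_le _)).2).trans (hwF 0 (Nat.zero_le _)))
  have hS : seminormH (s + ν + 1) w ^ 2 = ∫ x in (-1 : ℝ)..1, F (s + ν + 1) x ^ 2 := by
    rw [seminormH, Real.sq_sqrt (integral_nonneg fun x => sq_nonneg _), ← integral_Ω_eq]
    apply integral_congr_ae
    filter_upwards [hwF (s + ν + 1) le_rfl] with x hx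
    rw [hx]
  have hp : (p : ℝ) ^ (2 * (ν : ℤ) - 1) = (p : ℝ) ^ (2 * ν) * (p : ℝ)⁻¹ := by
    have : (p : ℝ) ≠ 0 := by exact_mod_cast (by omega : p ≠ 0)
    rw [zpow_sub₀ this, zpow_one, div_eq_mul_inv]
    norm_cast
  have hr : ((p - ν - s).factorial : ℝ) / ((p - ν + s).factorial : ℝ) =
      (factRatio (p - ν) s)⁻¹ := by rw [factRatio, inv_div]
  rw [sq_abs, hS, hp, hr]
  rcases hx with rfl | rfl
  · rw [hu.eqOn hrep (by norm_num)]
    exact sq_error_iterate_derivative_eval_one_le ν p s F _ hν hs hF hP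
  · rw [hu.eqOn hrep (by norm_num)]
    exact sq_error_iterate_derivative_eval_neg_one_le hν hs hF hP
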